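/- **Setting.** The Congested Clique on $n\ge 2$ nodes with IDs $0,\dots,n-1$ is the synchronous model in which, in every round, each node may send to each other node one (possibly different) message of $O(\log n)$ bits; local computation is free, and the message complexity is the total number of messages sent. Let $G=(V,E,w)$ be an $n$-node graph with distinct non-negative integer edge weights, each of $O(\log n)$ bits, let $F\subseteq G$ be a forest, and let $p\in(0,1]$. Run Borůvka's algorithm on $F$: $\mathcal C^i=\{C^i_1,C^i_2,\dots\}$ are the components at the beginning of phase $i$ ($\mathcal C^0$ consists of singletons), $e^i_j$ is the minimum weight edge of $F$ leaving $C^i_j$ (with $w(e^i_j)=\infty$ if there is none), and the next components arise by merging along all $e^i_j$; the phases are $i=0,\dots,\lceil\log_2 n\rceil$. The leader of $C^i_j$ is its node of smallest ID. Let $L^i_j$ be the set of edges of $G$ with exactly one endpoint in $C^i_j$ and weight at most $w(e^i_j)$. For a node $v\in C^i_j$ let $\mathbf a^i_v$ be the signed edge-incidence vector of $v$ in $G$ restricted to edges of weight at most $w(e^i_j)$ (entry $+1$ if $v$ is the smaller endpoint, $-1$ if it is the larger one), so that $\sum_{v\in C^i_j}\mathbf a^i_v$ has support $L^i_j$. For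 every phase, $\beta=O(\log^5 n/p)$ linear sketches are given, depending on a shared random seed: the $k$-th sketch of a vector is its image under an additive map into a finite abelian group whose elements have $O(\log^4 n)$ bits, together with a procedure that tries to read off a nonzero entry of a vector from its sketch. (The result holds for every value of the seed and whatever the accuracy of this procedure.) The $k$-th sketch of $C^i_j$ is the sum of the $k$-th sketches of $\mathbf a^i_v$ over $v\in C^i_j$. An edge is *sampled* if it is returned by the procedure on some sketch of some $C^i_j$ and lies in $L^i_j$ (otherwise the sampling from that sketch has failed). **Step 5 of Compute-F-Light** is the following task. Initially each node $v$ knows the seed, its incident edges in $G$ and in $F$ with their weights, and, for every phase $i$, the leader of its component $C^i_j$, the weight $w(e^i_j)$ and its own $\beta$ sketches of $\mathbf a^i_v$; moreover $\lceil\log_2 n\rceil+1$ fixed commander nodes know the whole weighted forest $F$. At the end, for all $i$ and $j$, the leader of $C^i_j$ must hold all $\beta$ sketches of $C^i_j$, and every node must know exactly which of its incident edges have been sampled, over all $i$ and $j$. **Lemma.** For every constant $\gamma<1$ and all $p$ with $n^{-\gamma}\le p\le 1$ (in particular for $p=\sqrt{n/m}$ where $m=|E|\ge n$, taking $\gamma=1/2$),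 Step 5 of Compute-F-Light can be implemented in the Congested Clique in $O(1)$ rounds using $\widetilde O(n/p)=O\big((n/p)\cdot\mathrm{poly}(\log n)\big)$ messages. The implied constants, including the one in the message size and the exponent of the polylogarithm, depend only on $\gamma$ and on the constants implied in the bounds on $\beta$, the sketch size and the weights. -/

import Mathlib

/-! ### The Congested Clique -/

/-- A synchronous message-passing algorithm on the clique with node set `Fin n` (a node is
identified with its ID, and all IDs are known to everybody).  `I` is the type of the local inputs
and `O` the type of the local outputs.  Local computation is unrestricted.  In round `t` a node `u`
may send to each node `v` one message from an alphabet with `n ^ b` letters, that is, of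
`b * log₂ n` bits; `none` means that nothing is sent. -/
structure CliqueProtocol (n b : ℕ) (I O : Type) where
  State : Type
  init : Fin n → I → State
  send : ℕ → (u : Fin n) → State → (v : Fin n) → Option (Fin (n ^ b))
  receive : ℕ → (v : Fin n) → State → ((u : Fin n) → Option (Fin (n ^ b))) → State
  output : Fin n → State → O

namespace CliqueProtocol

variable {n b : ℕ} {I O : Type} (P : CliqueProtocol n b I O)

/-- The message that travels from `u` to `v` in round `t` when the current states are `σ`.
There is no link from a node to itself. -/
def delivered (t : ℕ) (σ : Fin n → P.State) (u v : Fin n) : Option (Fin (n ^ b)) :=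
  if u = v then none else P.send t u (σ u) v

/-- The states of all nodes after `t` rounds on the local inputs `x`. -/
def stateAfter (x : Fin n → I) : ℕ → Fin n → P.State
  | 0 => fun v => P.init v (x v)
  | t + 1 => fun v =>
      P.receive t v (stateAfter x t v) (fun u => P.delivered t (stateAfter x t) u v)

/-- The local output of node `v` after `R` rounds on the local inputs `x`. -/
def result (x : Fin n → I) (R : ℕ) (v : Fin n) : O :=
  P.output v (P.stateAfter x R v)

/-- The total number of messages sent during the first `R` rounds on the local inputs `x`. -/
def messageCount (x : Fin n → I) (R : ℕ) : ℕ :=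
  ∑ t ∈ Finset.range R, ∑ u : Fin n, ∑ v : Fin n,
    if (P.delivered t (P.stateAfter x t) u v).isSome then 1 else 0

end CliqueProtocol

/-! ### Borůvka's algorithm on a forest -/

section Boruvka

variable {V : Type}

/-- The edges of `K` with exactly one endpoint in `S`. -/
def cutEdges (K : SimpleGraph V) (S : Set V) : Set (Sym2 V) :=
  {e | e ∈ K.edgeSet ∧ ∃ u ∈ S, ∃ v ∉ S, e = s(u, v)}

/-- `e` is a minimum weight edge of `F` that leaves `S`. -/
def IsMWOE (F : SimpleGraph V) (w : Sym2 V → ℕ) (S : Set V) (e : Sym2 V) : Prop :=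
  e ∈ cutEdges F S ∧ ∀ e' ∈ cutEdges F S, w e ≤ w e'

/-- The edges of `F` that Borůvka's algorithm on `F` has selected before phase `i`, for
`i = 0, 1, 2, …`: in each phase every current component selects its minimum weight outgoing edge
in `F`, if there is one. -/
def boruvka (F : SimpleGraph V) (w : Sym2 V → ℕ) : ℕ → SimpleGraph V
  | 0 => ⊥
  | i + 1 => boruvka F w i ⊔ SimpleGraph.fromEdgeSet
      {e | ∃ v : V, IsMWOE F w {u | (boruvka F w i).Reachable v u} e}

open Classical in
/-- The component of `v` at the beginning of phase `i`. -/
noncomputable def phaseComp [Fintype V] (F : SimpleGraph V) (w : Sym2 V → ℕ) (i : ℕ) (v : V) :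
    Finset V :=
  Finset.univ.filter fun u => (boruvka F w i).Reachable v u

/-- The weight of the minimum weight outgoing edge in `F` of the phase-`i` component of `v`;
it is `⊤` if no edge of `F` leaves that component. -/
noncomputable def phaseWeight [Fintype V] (F : SimpleGraph V) (w : Sym2 V → ℕ) (i : ℕ) (v : V) :
    ℕ∞ :=
  ⨅ e ∈ cutEdges F (phaseComp F w i v : Set V), (w e : ℕ∞)

/-- The edges of `G` that leave the phase-`i` component of `v` and weigh at most as much as its
minimum weight outgoing edge in `F`. -/
def lightCut [Fintype V] (G F : SimpleGraph V) (w : Sym2 V → ℕ) (i : ℕ) (v : V) :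
    Set (Sym2 V) :=
  {e | e ∈ cutEdges G (phaseComp F w i v : Set V) ∧ (w e : ℕ∞) ≤ phaseWeight F w i v}

theorem mem_phaseComp_self [Fintype V] (F : SimpleGraph V) (w : Sym2 V → ℕ) (i : ℕ) (v : V) :
    v ∈ phaseComp F w i v := by
  simp [phaseComp]

/-- The leader (node of smallest ID) of the phase-`i` component of `v`. -/
noncomputable def phaseLeader [Fintype V] [LinearOrder V] (F : SimpleGraph V) (w : Sym2 V → ℕ)
    (i : ℕ) (v : V) : V :=
  (phaseComp F w i v).min' ⟨v, mem_phaseComp_self F w i v⟩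

end Boruvka

/-- The number of phases: a component before phase `i` has at least `2 ^ i` nodes unless it is
already a component of `F`, so in phase `⌈log₂ n⌉` (counted from `0`) all components are components
of `F`.  This is also the number of commanders. -/
def numPhases (n : ℕ) : ℕ := Nat.clog 2 n + 1

/-! ### Linear sketches -/

open Classical in
/-- The signed incidence vector of `v` restricted to the edges of weight at most `x`: its nonzero
entries are the edges of `G` of weight at most `x` at `v`, with sign `1` at the smaller
endpoint and `-1` at the larger one. -/
noncomputable def incidenceVector {n : ℕ} (G : SimpleGraph (Fin n)) (w : Sym2 (Fin n) → ℕ)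
    (x : ℕ∞) (v : Fin n) : Sym2 (Fin n) → ℤ := fun e =>
  if e ∈ G.edgeSet ∧ v ∈ e ∧ (w e : ℕ∞) ≤ x then (if v = e.inf then 1 else -1) else 0

/-- A scheme of linear sketches for edge vectors on `n` nodes, with `β` sketches in every phase.
The sketches take values in an abelian group `A` (such as `(ℤ / q) ^ d` with coordinatewise
addition), they depend on a seed shared by all nodes, and they are linear.  `sample` is the
procedure that attempts to read off a nonzero entry of a vector from the sketch of the vector.  No
accuracy of it is demanded, so `ℓ₀`-samplers are a special case. -/
structure SketchScheme (n β : ℕ) (Seed A : Type) [AddCommGroup A] where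
  sketch : Seed → Fin (numPhases n) → Fin β → (Sym2 (Fin n) → ℤ) →+ A
  sample : Seed → Fin (numPhases n) → Fin β → A → Option (Sym2 (Fin n))

namespace SketchScheme

variable {n β : ℕ} {Seed A : Type} [AddCommGroup A] (S : SketchScheme n β Seed A)

/-- The `k`-th sketch that node `v` computes for its component in phase `i`. -/
noncomputable def nodeSketch (r : Seed) (G F : SimpleGraph (Fin n)) (w : Sym2 (Fin n) → ℕ)
    (i : Fin (numPhases n)) (k : Fin β) (v : Fin n) : A :=
  S.sketch r i k (incidenceVector G w (phaseWeight F w i v) v)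

/-- The `k`-th sketch of the phase-`i` component of `v`: the sum of the sketches of its nodes. -/
noncomputable def componentSketch (r : Seed) (G F : SimpleGraph (Fin n)) (w : Sym2 (Fin n) → ℕ)
    (i : Fin (numPhases n)) (k : Fin β) (v : Fin n) : A :=
  ∑ u ∈ phaseComp F w i v, S.nodeSketch r G F w i k u

/-- The edges sampled from all component sketches, over all phases and all components.  A sampling
is successful if it returns a nonzero entry of the sketched vector, that is, an edge in the
`lightCut` of the component; otherwise it fails and yields no edge. -/
def sampledEdges (r : Seed) (G F : SimpleGraph (Fin n)) (w : Sym2 (Fin n) → ℕ) :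
    Set (Sym2 (Fin n)) :=
  {e | ∃ (i : Fin (numPhases n)) (v : Fin n) (k : Fin β),
    S.sample r i k (S.componentSketch r G F w i k v) = some e ∧ e ∈ lightCut G F w i v}

end SketchScheme

/-! ### The gathering and sampling step -/

/-- What a node knows before the step. -/
structure LocalView (n β : ℕ) (Seed A : Type) where
  /-- the shared random seed of the sketches -/
  seed : Seed
  /-- the weight of the edge of `G` to each node, if there is such an edge -/
  incidentG : Fin n → Option ℕ
  /-- the weight of the edge of `F` to each node, if there is such an edge -/
  incidentF : Fin n → Option ℕ
  /-- for each phase, the leader of the own component -/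
  label : Fin (numPhases n) → Fin n
  /-- for each phase, the weight of the minimum weight outgoing edge of the own component -/
  weight : Fin (numPhases n) → ℕ∞
  /-- the own sketches for each phase -/
  sketches : Fin (numPhases n) → Fin β → A
  /-- for commanders only: the whole weighted forest `F` -/
  forest : Option (Sym2 (Fin n) → Option ℕ)

open Classical in
/-- The knowledge of node `v` before the step.  The commanders are the first `numPhases n` nodes. -/
noncomputable def localView {n β : ℕ} {Seed A : Type} [AddCommGroup A]
    (S : SketchScheme n β Seed A) (r : Seed) (G F : SimpleGraph (Fin n))
    (w : Sym2 (Fin n) → ℕ) (v : Fin n) : LocalView n β Seed A where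
  seed := r
  incidentG u := if G.Adj v u then some (w s(v, u)) else none
  incidentF u := if F.Adj v u then some (w s(v, u)) else none
  label i := phaseLeader F w i v
  weight i := phaseWeight F w i v
  sketches i k := S.nodeSketch r G F w i k v
  forest := if v.val < numPhases n then
      some fun e => if e ∈ F.edgeSet then some (w e) else none
    else none

/-- What a node outputs at the end of the step: component sketches (meaningful for component
leaders) and the set of incident edges it has been notified about. -/
structure StepOutput (n β : ℕ) (A : Type) where
  compSketches : Fin (numPhases n) → Fin β → A
  notified : Set (Sym2 (Fin n))

/-- The local outputs `out` are those required of the step: for every phase, the leader of every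
component holds all `β` sketches of the component, and every node knows exactly which of its
incident edges have been sampled from some component sketch in some phase. -/
def StepCorrect {n β : ℕ} {Seed A : Type} [AddCommGroup A]
    (S : SketchScheme n β Seed A) (r : Seed) (G F : SimpleGraph (Fin n))
    (w : Sym2 (Fin n) → ℕ) (out : Fin n → StepOutput n β A) : Prop :=
  (∀ (i : Fin (numPhases n)) (v : Fin n) (k : Fin β),
    (out (phaseLeader F w i v)).compSketches i k = S.componentSketch r G F w i k v) ∧
  (∀ v : Fin n, (out v).notified = {e | e ∈ S.sampledEdges r G F w ∧ v ∈ e})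

/-! Put Q = `numPhases n * β`, the number of sketches of a node, and let T be a number of messages
that suffices for a group element. The engine is `realizes_route`: a packet is cut into T pieces
that travel in two rounds through the T relays of its block, and no link is overloaded if packets of
one block have distinct sources and distinct destinations. Blocks, relays and helpers are fixed
independently of the input, so nothing has to be coordinated. Each node hosts a constant number of
virtual nodes, and there is room for all relays once QT² = O(n). Since Q = O(log^6 n / p) and T =
O(log^3 n), this follows from p ≥ n^(-γ) with γ < 1 (`log_pow_div_le`).

A leader cannot receive one packet from every node of a large component. So the nodes are split into
T groups, none larger than the number of blocks. For each phase, sketch number and group, a helper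
adds up the sketches component by component and returns the partial sums (`realizes_groupSketch`).
One representative per group and component forwards its sum, so a leader gets at most T packets per
sketch (`realizes_leaderSketch`). Knowing its members (`realizes_members`), it sends a sampled edge
to the endpoint inside, which checks adjacency and weight (`realizes_hit`) and notifies the other
endpoint (`realizes_out`). This takes 4 + 2 + 1 + 2 + 1 = 10 rounds and O(nQT + n · `numPhases n`)
messages. -/

/-- `Realizes b R N x y`: some protocol with messages from `n ^ b` letters turns the local inputs
`x θ` into the local outputs `y θ` within `R` rounds and with at most `N` messages, for every
value of the global parameter `θ`. -/
def Realizes {n : ℕ} {Θ I O : Type} (b R N : ℕ) (x : Θ → Fin n → I) (y : Θ → Fin n → O) : Prop :=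
  ∃ P : CliqueProtocol n b I O,
    ∀ θ, (∀ v, P.result (x θ) R v = y θ v) ∧ P.messageCount (x θ) R ≤ N

/-- `y` is a function of the local knowledge `x`. -/
def Determines {n : ℕ} {Θ I O : Type} (x : Θ → Fin n → I) (y : Θ → Fin n → O) : Prop :=
  ∀ θ θ' v, x θ v = x θ' v → y θ v = y θ' v

/-! ### Sequential composition of protocols. -/

namespace CliqueProtocol

variable {n b : ℕ} {I J O : Type}

/-- Run `P` for `R` rounds and feed its outputs to `Q`. -/
def seqComp (P : CliqueProtocol n b I J) (R : ℕ) (Q : CliqueProtocol n b J O) :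
    CliqueProtocol n b I O where
  State := P.State ⊕ Q.State
  init v i := Sum.inl (P.init v i)
  send t u s v :=
    if t < R then s.elim (fun σ => P.send t u σ v) (fun _ => none)
    -- From round `R` on, a left state stands for the initial state of `Q` on the output of `P`, so
    -- the handover costs no round.
    else Q.send (t - R) u (s.elim (fun σ => Q.init u (P.output u σ)) id) v
  receive t v s m :=
    if t < R then s.elim (fun σ => Sum.inl (P.receive t v σ m)) Sum.inr
    else Sum.inr (Q.receive (t - R) v (s.elim (fun σ => Q.init v (P.output v σ)) id) m)
  output v s := Q.output v (s.elim (fun σ => Q.init v (P.output v σ)) id)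

variable (P : CliqueProtocol n b I J) (R : ℕ) (Q : CliqueProtocol n b J O) (x : Fin n → I)

theorem seqComp_stateAfter_of_le {t : ℕ} (ht : t ≤ R) (v : Fin n) :
    (P.seqComp R Q).stateAfter x t v = Sum.inl (P.stateAfter x t v) := by
  induction t generalizing v with
  | zero => rfl
  | succ t ih =>
    have ih' := fun v => ih (by omega) v
    have hlt : t < R := by omega
    simp only [stateAfter]
    rw [ih' v]
    simp only [seqComp, hlt, if_true, Sum.elim_inl]
    congr 2
    funext u
    simp only [delivered]
    have := ih' u
    simp only [seqComp] at this
    rw [this]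
    simp [hlt]

theorem seqComp_delivered_of_lt {t : ℕ} (ht : t < R) (u v : Fin n) :
    (P.seqComp R Q).delivered t ((P.seqComp R Q).stateAfter x t) u v =
      P.delivered t (P.stateAfter x t) u v := by
  simp only [delivered, seqComp_stateAfter_of_le P R Q x ht.le]
  simp [seqComp, ht]

theorem seqComp_stateAfter_add (t : ℕ) (v : Fin n) :
    ((P.seqComp R Q).stateAfter x (R + t) v).elim (fun σ => Q.init v (P.output v σ)) id =
      Q.stateAfter (P.result x R) t v := by
  induction t generalizing v with
  | zero =>
    rw [Nat.add_zero, seqComp_stateAfter_of_le P R Q x le_rfl]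
    rfl
  | succ t ih =>
    rw [← Nat.add_assoc]
    simp only [stateAfter]
    simp only [seqComp, show ¬ (R + t < R) by omega, if_false, Sum.elim_inr, id,
      Nat.add_sub_cancel_left, delivered]
    simp only [seqComp] at ih
    rw [ih v]
    congr 1
    funext u
    rw [ih u]

theorem seqComp_delivered_add (t : ℕ) (u v : Fin n) :
    (P.seqComp R Q).delivered (R + t) ((P.seqComp R Q).stateAfter x (R + t)) u v =
      Q.delivered t (Q.stateAfter (P.result x R) t) u v := by
  simp only [delivered, ← seqComp_stateAfter_add]
  simp [seqComp]

theorem seqComp_messageCount (R' : ℕ) :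
    (P.seqComp R Q).messageCount x (R + R') =
      P.messageCount x R + Q.messageCount (P.result x R) R' := by
  unfold messageCount
  rw [Finset.sum_range_add]
  congr 1
  · refine Finset.sum_congr rfl fun t ht => ?_
    simp only [seqComp_delivered_of_lt P R Q x (Finset.mem_range.1 ht)]
  · simp only [seqComp_delivered_add]

theorem seqComp_result (R' : ℕ) :
    (P.seqComp R Q).result x (R + R') = Q.result (P.result x R) R' := by
  funext v
  simp only [result, ← seqComp_stateAfter_add]
  rfl

end CliqueProtocol

/-! ### Single rounds and routing, phrased through what each node's knowledge determines. -/

section Realizes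

variable {n : ℕ} {Θ I J O : Type} {b R R' N N' : ℕ}

theorem Realizes.trans {x : Θ → Fin n → I} {y : Θ → Fin n → J} {z : Θ → Fin n → O}
    (h : Realizes b R N x y) (h' : Realizes b R' N' y z) :
    Realizes b (R + R') (N + N') x z := by
  obtain ⟨P, hP⟩ := h
  obtain ⟨Q, hQ⟩ := h'
  refine ⟨P.seqComp R Q, fun θ => ?_⟩
  have hr : P.result (x θ) R = y θ := funext (hP θ).1
  rw [CliqueProtocol.seqComp_result, CliqueProtocol.seqComp_messageCount, hr]
  exact ⟨(hQ θ).1, add_le_add (hP θ).2 (hQ θ).2⟩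

/-- As local computation is free, a node can compute whatever its knowledge determines. Algorithms
can therefore be described by the quantities known after each stage instead of by programs. -/
theorem Determines.exists_fun [Nonempty Θ] {x : Θ → Fin n → I} {y : Θ → Fin n → O}
    (h : Determines x y) : ∃ f : Fin n → I → O, ∀ θ v, f v (x θ v) = y θ v := by
  classical
  obtain ⟨θ₀⟩ := ‹Nonempty Θ›
  refine ⟨fun v i => if hi : ∃ θ, x θ v = i then y hi.choose v else y θ₀ v, fun θ v => ?_⟩
  have hi : ∃ θ', x θ' v = x θ v := ⟨θ, rfl⟩
  simp only [hi, dif_pos]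
  exact h _ _ _ hi.choose_spec

theorem Determines.realizes [Nonempty Θ] {x : Θ → Fin n → I} {y : Θ → Fin n → O}
    (h : Determines x y) : Realizes b 0 0 x y := by
  obtain ⟨f, hf⟩ := h.exists_fun
  exact ⟨⟨I, fun _ i => i, fun _ _ _ _ => none, fun _ _ s _ => s, f⟩,
    fun θ => ⟨fun v => hf θ v, by simp [CliqueProtocol.messageCount]⟩⟩

theorem Realizes.determines [Nonempty Θ] {x : Θ → Fin n → I} {y : Θ → Fin n → J}
    {z : Θ → Fin n → O} (h : Realizes b R N x y) (h' : Determines y z) :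
    Realizes b R N x z := by
  simpa using h.trans (h'.realizes (b := b))

/-- One round in which `u` sends the message `m θ u v` to `v`. -/
theorem realizes_oneRound [Nonempty Θ] {X : Type} [Finite X] (hX : Nat.card X ≤ n ^ b)
    {x : Θ → Fin n → I} (m : Θ → Fin n → Fin n → Option X) (hm : Determines x m)
    (hN : ∀ θ, (∑ u, ∑ v, if (m θ u v).isSome then 1 else 0) ≤ N) :
    Realizes b 1 N x (fun θ v => (x θ v, fun u => m θ u v)) := by
  classical
  obtain ⟨f, hf⟩ := hm.exists_fun
  have := Fintype.ofFinite X
  obtain ⟨e⟩ : Nonempty (X ↪ Fin (n ^ b)) := by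
    apply Function.Embedding.nonempty_of_card_le
    simpa [Nat.card_eq_fintype_card] using hX
  refine ⟨⟨I × (Fin n → Option X), fun _ i => (i, fun _ => none),
    fun _ u s v => (f u s.1 v).map e,
    -- There is no link from a node to itself, so its own message is recomputed from its input.
    fun _ v s c => (s.1, fun u => if u = v then f v s.1 v else (c u).bind (Function.partialInv e)),
    fun _ s => s⟩, fun θ => ⟨fun v => ?_, ?_⟩⟩
  · simp only [CliqueProtocol.result, CliqueProtocol.stateAfter, CliqueProtocol.delivered, hf]
    congr 1
    funext u
    by_cases h : u = v
    · simp [h]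
    · simp only [h, if_false]
      cases m θ u v with
      | none => rfl
      | some q => simp [Function.partialInv_left e.injective]
  · refine le_trans ?_ (hN θ)
    simp only [CliqueProtocol.messageCount, Finset.sum_range_one]
    refine Finset.sum_le_sum fun u _ => Finset.sum_le_sum fun v _ => ?_
    simp only [CliqueProtocol.delivered, CliqueProtocol.stateAfter, hf]
    by_cases h : u = v
    · simp [h]
    · simp [h]

/-- One round between virtual nodes, of which every node hosts `C`. -/
theorem realizes_slotRound [Nonempty Θ] {C : ℕ} {Y : Type} [Finite Y]
    (hY : (Nat.card Y + 1) ^ (C * C) ≤ n ^ b) {x : Θ → Fin n → I}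
    (m : Θ → Fin n × Fin C → Fin n × Fin C → Option Y)
    (hm : ∀ θ θ' a, x θ a.1 = x θ' a.1 → m θ a = m θ' a)
    (hN : ∀ θ, (∑ a, ∑ c, if (m θ a c).isSome then 1 else 0) ≤ N) :
    Realizes b 1 N x (fun θ v => (x θ v, fun a c => m θ a (v, c))) := by
  classical
  have hcard : Nat.card (Fin C → Fin C → Option Y) ≤ n ^ b := by
    have := Fintype.ofFinite Y
    refine le_trans (le_of_eq ?_) hY
    simp only [Nat.card_eq_fintype_card, Fintype.card_fun, Fintype.card_fin, Fintype.card_option]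
    rw [← pow_mul]
  -- All messages between the slots of `u` and those of `v` form one bundle. Nothing is sent when
  -- all of them are empty, so bundling cannot increase the message count.
  let m' : Θ → Fin n → Fin n → Option (Fin C → Fin C → Option Y) := fun θ u v =>
    if ∃ j k, (m θ (u, j) (v, k)).isSome then some fun j k => m θ (u, j) (v, k) else none
  have key := realizes_oneRound (N := N) hcard (x := x) m' (fun θ θ' u h => by
    have := fun j => hm θ θ' (u, j) h
    simp only [m', this]) (fun θ => by
    refine le_trans ?_ (hN θ)
    rw [Fintype.sum_prod_type]
    refine Finset.sum_le_sum fun u _ => ?_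
    simp_rw [Fintype.sum_prod_type]
    rw [Finset.sum_comm]
    refine Finset.sum_le_sum fun v _ => ?_
    by_cases h : ∃ j k, (m θ (u, j) (v, k)).isSome
    · obtain ⟨j, k, hjk⟩ := h
      calc _ ≤ 1 := by split_ifs <;> simp
        _ = (if (m θ (u, j) (v, k)).isSome then 1 else 0) := by simp [hjk]
        _ ≤ ∑ k, (if (m θ (u, j) (v, k)).isSome then 1 else 0) :=
          Finset.single_le_sum (f := fun k => if (m θ (u, j) (v, k)).isSome then 1 else 0)
            (fun _ _ => Nat.zero_le _) (Finset.mem_univ k)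
        _ ≤ _ := Finset.single_le_sum
            (f := fun j => ∑ k, (if (m θ (u, j) (v, k)).isSome then 1 else 0))
            (fun _ _ => Nat.zero_le _) (Finset.mem_univ j)
    · simp [m', h])
  refine key.determines fun θ θ' v h => ?_
  simp only [Prod.mk.injEq] at h ⊢
  refine ⟨h.1, ?_⟩
  funext a c
  have h2 := congrFun h.2 a.1
  have aux : ∀ θ, m θ a (v, c) = (m' θ a.1 v).elim none (fun g => g a.2 c) := by
    intro θ
    simp only [m']
    split_ifs with hh
    · rfl
    · push Not at hh
      have := hh a.2 c
      simpa using this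
  rw [aux θ, aux θ', h2]

open Classical in
/-- Some element with the property `P`, if there is one. -/
noncomputable def pick {α : Type} (P : α → Prop) : Option α :=
  if h : ∃ a, P a then some h.choose else none

theorem pick_spec {α : Type} {P : α → Prop} {a : α} (h : pick P = some a) : P a := by
  unfold pick at h
  split_ifs at h with h'
  obtain rfl := Option.some.inj h
  exact h'.choose_spec

theorem exists_pick {α : Type} {P : α → Prop} {a : α} (h : P a) : ∃ a, pick P = some a := by
  have h' : ∃ a, P a := ⟨a, h⟩
  exact ⟨h'.choose, by simp [pick, h']⟩

theorem pick_eq_some_iff {α : Type} {P : α → Prop} (hP : ∀ a a', P a → P a' → a = a') (a : α) :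
    pick P = some a ↔ P a := by
  refine ⟨pick_spec, fun h => ?_⟩
  obtain ⟨a', h'⟩ := exists_pick h
  rw [h', hP _ _ (pick_spec h') h]

/-- Messages are counted by listing the links that may be used; repetitions and unused links in the
list do no harm. -/
theorem sum_isSome_le_card {α δ ι Y : Type} [Fintype α] [Fintype δ] [Fintype ι]
    (m : α → δ → Option Y) (f : ι → α × δ)
    (h : ∀ a c, (m a c).isSome → ∃ i, f i = (a, c)) :
    (∑ a, ∑ c, if (m a c).isSome then 1 else 0) ≤ Fintype.card ι := by
  classical
  rw [← Fintype.sum_prod_type' (f := fun a c => if (m a c).isSome then 1 else 0),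
    ← Finset.card_filter, ← Finset.card_univ]
  refine le_trans (Finset.card_le_card (t := Finset.univ.image f) ?_) Finset.card_image_le
  rintro ⟨a, c⟩ hac
  simpa using h a c (by simpa using hac)

open Classical in
/-- Routing of packets `pk θ j` from `src j` through `T` parallel relays of the block `blk j`.
No two packets in a block share their source or their destination. -/
theorem realizes_route [Nonempty Θ] {C T : ℕ} [NeZero T] {K D Z B : Type} [Fintype K]
    [Finite Z] (hZ : (Nat.card ((Fin n × Fin C) × Z) + 1) ^ (C * C) ≤ n ^ b)
    (relay : B × Fin T ↪ Fin n × Fin C) (enc : K × D ↪ (Fin T → Z))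
    {x : Θ → Fin n → I} (src : K → Fin n × Fin C) (blk : K → B)
    (pk : Θ → K → Option ((Fin n × Fin C) × D))
    (hsrc : ∀ j j', blk j = blk j' → src j = src j' → j = j')
    (hdst : ∀ θ j j' w d d', blk j = blk j' → pk θ j = some (w, d) → pk θ j' = some (w, d') →
      j = j')
    (hpk : ∀ θ θ' j, x θ (src j).1 = x θ' (src j).1 → pk θ j = pk θ' j) :
    Realizes b 2 (2 * (Fintype.card K * T)) x (fun θ v => (x θ v, fun j =>
      (pk θ j).bind fun q => if q.1.1 = v then some q.2 else none)) := by
  -- First round: piece `t` goes to the `t`-th relay of the block, labelled with its destination.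
  -- The relay determines block and `t`, so by `hsrc` a link carries at most one piece.
  let m₁ : Θ → Fin n × Fin C → Fin n × Fin C → Option ((Fin n × Fin C) × Z) := fun θ a c =>
    pick fun q => ∃ j t d, pk θ j = some (q.1, d) ∧ src j = a ∧ relay (blk j, t) = c ∧
      q.2 = enc (j, d) t
  have hm₁ : ∀ θ a c q, m₁ θ a c = some q ↔ ∃ j t d, pk θ j = some (q.1, d) ∧ src j = a ∧
      relay (blk j, t) = c ∧ q.2 = enc (j, d) t := by
    intro θ a c q
    refine pick_eq_some_iff ?_ q
    rintro ⟨w, z⟩ ⟨w', z'⟩ ⟨j, t, d, h1, h2, h3, h4⟩ ⟨j', t', d', h1', h2', h3', h4'⟩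
    have := relay.injective (h3.trans h3'.symm)
    simp only [Prod.mk.injEq] at this
    obtain rfl := hsrc j j' this.1 (h2.trans h2'.symm)
    obtain rfl := this.2
    simp only at h1 h1' h4 h4'
    rw [h1] at h1'
    simp only [Option.some.injEq, Prod.mk.injEq] at h1'
    obtain ⟨rfl, rfl⟩ := h1'
    rw [h4, h4']
  -- Second round: a relay forwards pieces by their destination label alone, and `hdst` prevents
  -- collisions.
  let m₂ : Θ → Fin n × Fin C → Fin n × Fin C → Option ((Fin n × Fin C) × Z) := fun θ c w =>
    pick fun q => q.1 = w ∧ ∃ a, m₁ θ a c = some q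
  have hm₂ : ∀ θ c w q, m₂ θ c w = some q ↔ q.1 = w ∧ ∃ j t d, pk θ j = some (w, d) ∧
      relay (blk j, t) = c ∧ q.2 = enc (j, d) t := by
    intro θ c w q
    have : (q.1 = w ∧ ∃ a, m₁ θ a c = some q) ↔ (q.1 = w ∧ ∃ j t d, pk θ j = some (w, d) ∧
      relay (blk j, t) = c ∧ q.2 = enc (j, d) t) := by
      simp only [hm₁]
      constructor
      · rintro ⟨rfl, a, j, t, d, h1, h2, h3, h4⟩
        exact ⟨rfl, j, t, d, h1, h3, h4⟩
      · rintro ⟨rfl, j, t, d, h1, h3, h4⟩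
        exact ⟨rfl, src j, j, t, d, h1, rfl, h3, h4⟩
    rw [← this]
    refine pick_eq_some_iff ?_ q
    rintro ⟨w, z⟩ ⟨w', z'⟩ ⟨rfl, a, h⟩ ⟨h', a', h''⟩
    simp only at h'
    subst h'
    rw [hm₁] at h h''
    obtain ⟨j, t, d, h1, h2, h3, h4⟩ := h
    obtain ⟨j', t', d', h1', h2', h3', h4'⟩ := h''
    have := relay.injective (h3.trans h3'.symm)
    simp only [Prod.mk.injEq] at this
    obtain rfl := this.2
    obtain rfl := hdst θ j j' _ d d' this.1 h1 h1'
    simp only at h1 h1' h4 h4'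
    rw [h1] at h1'
    simp only [Option.some.injEq, Prod.mk.injEq] at h1'
    rw [h4, h4', h1'.2]
  have r₁ := realizes_slotRound (N := Fintype.card K * T) hZ (x := x) m₁
    (fun θ θ' a h => by
      funext c
      simp only [m₁]
      congr 1
      funext q
      refine propext (exists_congr fun j => exists_congr fun t => exists_congr fun d => ?_)
      constructor
      · rintro ⟨h1, rfl, h2⟩
        exact ⟨(hpk θ θ' j h) ▸ h1, rfl, h2⟩
      · rintro ⟨h1, rfl, h2⟩
        exact ⟨(hpk θ θ' j h) ▸ h1, rfl, h2⟩)
    (fun θ => by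
      refine (sum_isSome_le_card (ι := K × Fin T) (m₁ θ)
        (fun i => (src i.1, relay (blk i.1, i.2))) ?_).trans (by simp)
      intro a c h
      obtain ⟨q, hq⟩ := Option.isSome_iff_exists.1 h
      obtain ⟨j, t, d, -, h2, h3, -⟩ := (hm₁ _ _ _ _).1 hq
      exact ⟨(j, t), by simp [h2, h3]⟩)
  have r₂ := realizes_slotRound (N := Fintype.card K * T) hZ
    (x := fun θ v => (x θ v, fun (a : Fin n × Fin C) (c : Fin C) => m₁ θ a (v, c))) m₂
    (fun θ θ' c h => by
      funext w
      simp only [m₂]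
      simp only [Prod.mk.injEq] at h
      have : ∀ a, m₁ θ a c = m₁ θ' a c := fun a => congrFun (congrFun h.2 a) c.2
      simp only [this])
    (fun θ => by
      refine (sum_isSome_le_card (ι := K × Fin T) (m₂ θ)
        (fun i => (relay (blk i.1, i.2), ((pk θ i.1).elim (src i.1) Prod.fst))) ?_).trans (by simp)
      intro a c h
      obtain ⟨q, hq⟩ := Option.isSome_iff_exists.1 h
      obtain ⟨-, j, t, d, h2, h3, -⟩ := (hm₂ _ _ _ _).1 hq
      exact ⟨(j, t), by simp [h2, h3]⟩)
  -- Pieces reaching `w` through one block stem from a single packet by `hdst`. The code contains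
  -- the index of the packet, so `w` recognizes which packet it received.
  have hrec : ∀ θ w j d, pk θ j = some (w, d) ↔
      ∀ t, m₂ θ (relay (blk j, t)) w = some (w, enc (j, d) t) := by
    intro θ w j d
    constructor
    · intro h t
      exact (hm₂ _ _ _ _).2 ⟨rfl, j, t, d, h, rfl, rfl⟩
    · intro h
      have h' : ∀ t, ∃ j' d', pk θ j' = some (w, d') ∧ blk j' = blk j ∧
          enc (j, d) t = enc (j', d') t := by
        intro t
        obtain ⟨-, j', t', d', h1, h2, h3⟩ := (hm₂ _ _ _ _).1 (h t)
        have := relay.injective h2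
        simp only [Prod.mk.injEq] at this
        obtain ⟨h4, rfl⟩ := this
        exact ⟨j', d', h1, h4, h3⟩
      obtain ⟨j₀, d₀, h1, h2, -⟩ := h' 0
      have : enc (j, d) = enc (j₀, d₀) := by
        funext t
        obtain ⟨j', d', h1', h2', h3'⟩ := h' t
        obtain rfl := hdst θ j₀ j' w _ _ (h2.trans h2'.symm) h1 h1'
        rw [h1] at h1'
        simp only [Option.some.injEq, Prod.mk.injEq] at h1'
        rw [h3', h1'.2]
      have := enc.injective this
      simp only [Prod.mk.injEq] at this
      rw [this.1, this.2, h1]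
  have r := (r₁.trans r₂).determines (z := fun θ v => (x θ v, fun j =>
      (pk θ j).bind fun q => if q.1.1 = v then some q.2 else none)) (by
    intro θ θ' v h
    simp only [Prod.mk.injEq] at h ⊢
    refine ⟨h.1.1, ?_⟩
    funext j
    have hm : ∀ c (w : Fin n × Fin C), w.1 = v → m₂ θ c w = m₂ θ' c w := by
      rintro c ⟨v', k⟩ rfl
      exact congrFun (congrFun h.2 c) k
    have hiff : ∀ w d, w.1 = v → (pk θ j = some (w, d) ↔ pk θ' j = some (w, d)) := by
      intro w d hw
      rw [hrec, hrec]
      simp only [hm _ w hw]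
    ext d
    simp only [Option.bind_eq_some_iff, Option.ite_none_right_eq_some, Option.some.injEq]
    constructor
    · rintro ⟨⟨w, d'⟩, h1, h2, rfl⟩
      exact ⟨(w, d'), (hiff w _ h2).1 h1, h2, rfl⟩
    · rintro ⟨⟨w, d'⟩, h1, h2, rfl⟩
      exact ⟨(w, d'), (hiff w _ h2).2 h1, h2, rfl⟩)
  convert r using 1
  ring

end Realizes

/-! ### Components and their leaders. -/

section Components

variable {V : Type} [Fintype V] (F : SimpleGraph V) (w : Sym2 V → ℕ) (i : ℕ)

theorem mem_phaseComp {u v : V} : u ∈ phaseComp F w i v ↔ (boruvka F w i).Reachable v u := by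
  simp [phaseComp]

theorem phaseComp_eq_of_mem {u v : V} (h : u ∈ phaseComp F w i v) :
    phaseComp F w i u = phaseComp F w i v := by
  rw [mem_phaseComp] at h
  ext x
  simp only [mem_phaseComp]
  exact ⟨h.trans, h.symm.trans⟩

theorem phaseWeight_eq_of_mem {u v : V} (h : u ∈ phaseComp F w i v) :
    phaseWeight F w i u = phaseWeight F w i v := by
  simp only [phaseWeight, phaseComp_eq_of_mem F w i h]

variable [LinearOrder V]

theorem phaseLeader_mem (v : V) : phaseLeader F w i v ∈ phaseComp F w i v :=
  Finset.min'_mem _ _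

theorem phaseLeader_eq_of_phaseComp_eq {u v : V} (h : phaseComp F w i u = phaseComp F w i v) :
    phaseLeader F w i u = phaseLeader F w i v := by
  simp only [phaseLeader, h]

/-- A leader belongs to its own component, so a common leader forces a common component. Leaders
thus serve as component names. -/
theorem mem_phaseComp_iff_phaseLeader_eq {u v : V} :
    u ∈ phaseComp F w i v ↔ phaseLeader F w i u = phaseLeader F w i v := by
  constructor
  · exact fun h => phaseLeader_eq_of_phaseComp_eq F w i (phaseComp_eq_of_mem F w i h)
  · intro h
    have hu := phaseComp_eq_of_mem F w i (phaseLeader_mem F w i u)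
    have hv := phaseComp_eq_of_mem F w i (phaseLeader_mem F w i v)
    rw [← hv, ← h, hu]
    exact mem_phaseComp_self F w i u

end Components

/-! ### Groups, partial sums and the combinatorics of sampled edges. -/

/-- The global input of the gathering and sampling step. -/
structure StepInput (n : ℕ) (Seed : Type) where
  seed : Seed
  G : SimpleGraph (Fin n)
  F : SimpleGraph (Fin n)
  w : Sym2 (Fin n) → ℕ

namespace StepInput

variable {n β T C : ℕ} {Seed A : Type} [AddCommGroup A]

/-- The leader of the phase-`i` component of `v`. -/
noncomputable def leader (θ : StepInput n Seed) (i : ℕ) (v : Fin n) : Fin n :=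
  phaseLeader θ.F θ.w i v

/-- The members of the group of `u` that lie in its phase-`i` component. -/
noncomputable def groupComp (grp : Fin n → Fin T) (θ : StepInput n Seed) (i : ℕ) (u : Fin n) :
    Finset (Fin n) :=
  Finset.univ.filter fun u' => grp u' = grp u ∧ θ.leader i u' = θ.leader i u

theorem self_mem_groupComp (grp : Fin n → Fin T) (θ : StepInput n Seed) (i : ℕ) (u : Fin n) :
    u ∈ θ.groupComp grp i u := by
  simp [groupComp]

/-- The smallest member of `groupComp`. -/
noncomputable def groupRep (grp : Fin n → Fin T) (θ : StepInput n Seed) (i : ℕ) (u : Fin n) :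
    Fin n :=
  (θ.groupComp grp i u).min' ⟨u, θ.self_mem_groupComp grp i u⟩

theorem groupComp_congr {grp : Fin n → Fin T} {θ : StepInput n Seed} {i : ℕ} {u u' : Fin n}
    (h : grp u = grp u') (h' : θ.leader i u = θ.leader i u') :
    θ.groupComp grp i u = θ.groupComp grp i u' := by
  simp only [groupComp, h, h']

theorem groupRep_mem (grp : Fin n → Fin T) (θ : StepInput n Seed) (i : ℕ) (u : Fin n) :
    θ.groupRep grp i u ∈ θ.groupComp grp i u :=
  Finset.min'_mem _ _

theorem groupRep_congr {grp : Fin n → Fin T} {θ : StepInput n Seed} {i : ℕ} {u u' : Fin n}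
    (h : grp u = grp u') (h' : θ.leader i u = θ.leader i u') :
    θ.groupRep grp i u = θ.groupRep grp i u' := by
  simp only [groupRep, groupComp_congr h h']

variable (S : SketchScheme n β Seed A)

/-- The local views of all nodes. -/
noncomputable def view (θ : StepInput n Seed) : Fin n → LocalView n β Seed A :=
  localView S θ.seed θ.G θ.F θ.w

/-- The sketch of a node with a given phase and number. -/
noncomputable def sketch (θ : StepInput n Seed) (k : Fin (numPhases n) × Fin β) (v : Fin n) : A :=
  S.nodeSketch θ.seed θ.G θ.F θ.w k.1 k.2 v

/-- The sum of the sketches over `groupComp`. -/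
noncomputable def groupSketch (grp : Fin n → Fin T) (θ : StepInput n Seed)
    (k : Fin (numPhases n) × Fin β) (u : Fin n) : A :=
  ∑ u' ∈ θ.groupComp grp k.1 u, θ.sketch S k u'

/-- The sum of the sketches over the component led by `v`; it is `0` if `v` is no leader. -/
noncomputable def leaderSketch (θ : StepInput n Seed) (k : Fin (numPhases n) × Fin β)
    (v : Fin n) : A :=
  ∑ u with θ.leader k.1 u = v, θ.sketch S k u

/-- The edge sampled by the leader `v` joins the node `q.1` of its component to the node `q.2`
outside of it. -/
def Candidate (θ : StepInput n Seed) (k : Fin (numPhases n) × Fin β) (v : Fin n)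
    (q : Fin n × Fin n) : Prop :=
  S.sample θ.seed k.1 k.2 (θ.leaderSketch S k v) = some s(q.1, q.2) ∧
    θ.leader k.1 q.1 = v ∧ θ.leader k.1 q.2 ≠ v

/-- The edge from `a` to `b` has been sampled from a sketch of a component of `a`. -/
def Hit (θ : StepInput n Seed) (a b : Fin n) : Prop :=
  ∃ v k, θ.Candidate S k v (a, b) ∧ θ.G.Adj a b ∧
    (θ.w s(a, b) : ℕ∞) ≤ phaseWeight θ.F θ.w k.1 a

/-- The edge is determined by the sample, and its orientation by which endpoint lies in the
component. -/
theorem Candidate.unique {θ : StepInput n Seed} {k : Fin (numPhases n) × Fin β} {v : Fin n}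
    (q q' : Fin n × Fin n) (h : θ.Candidate S k v q) (h' : θ.Candidate S k v q') : q = q' := by
  obtain ⟨h1, h2, h3⟩ := h
  obtain ⟨h1', h2', h3'⟩ := h'
  rw [h1, Option.some.injEq, Sym2.eq_iff] at h1'
  rcases h1' with ⟨h4, h5⟩ | ⟨h4, h5⟩
  · exact Prod.ext h4 h5
  · rw [← h5] at h2'
    exact absurd h2' h3

theorem pick_candidate_eq_some {θ : StepInput n Seed} {k : Fin (numPhases n) × Fin β} {v : Fin n}
    (q : Fin n × Fin n) : pick (θ.Candidate S k v) = some q ↔ θ.Candidate S k v q :=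
  pick_eq_some_iff (Candidate.unique S) q

theorem componentSketch_eq (θ : StepInput n Seed) (i : Fin (numPhases n)) (k : Fin β)
    (v : Fin n) : S.componentSketch θ.seed θ.G θ.F θ.w i k v =
      θ.leaderSketch S (i, k) (θ.leader i v) := by
  unfold SketchScheme.componentSketch leaderSketch
  refine Finset.sum_congr ?_ fun _ _ => rfl
  ext u
  rw [mem_phaseComp_iff_phaseLeader_eq, Finset.mem_filter]
  simp [leader]

/-- The fibres of `groupRep` cut a component into its intersections with the groups, each counted
once through its representative. -/
theorem sum_groupSketch (grp : Fin n → Fin T) (θ : StepInput n Seed)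
    (k : Fin (numPhases n) × Fin β) (v : Fin n) :
    (∑ u, if θ.groupRep grp k.1 u = u ∧ θ.leader k.1 u = v then θ.groupSketch S grp k u else 0) =
      θ.leaderSketch S k v := by
  rw [← Finset.sum_filter]
  unfold groupSketch leaderSketch
  rw [← Finset.sum_fiberwise_of_maps_to
    (s := Finset.univ.filter fun u => θ.leader k.1 u = v)
    (t := Finset.univ.filter fun u => θ.groupRep grp k.1 u = u ∧ θ.leader k.1 u = v)
    (g := θ.groupRep grp k.1)]
  · refine Finset.sum_congr rfl fun u hu => Finset.sum_congr ?_ fun _ _ => rfl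
    simp only [Finset.mem_filter, Finset.mem_univ, true_and] at hu
    ext u'
    simp only [Finset.mem_filter, Finset.mem_univ, true_and, groupComp]
    constructor
    · rintro ⟨h1, h2⟩
      exact ⟨h2.trans hu.2, by rw [groupRep_congr h1 h2, hu.1]⟩
    · rintro ⟨h1, h2⟩
      have := θ.groupRep_mem grp k.1 u'
      rw [h2] at this
      simp only [groupComp, Finset.mem_filter, Finset.mem_univ, true_and] at this
      exact ⟨this.1.symm, this.2.symm⟩
  · intro u hu
    simp only [Finset.mem_filter, Finset.mem_univ, true_and] at hu ⊢
    have := θ.groupRep_mem grp k.1 u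
    simp only [groupComp, Finset.mem_filter, Finset.mem_univ, true_and] at this
    exact ⟨groupRep_congr this.1 this.2, this.2.trans hu⟩

theorem Hit.mem_sampledEdges {θ : StepInput n Seed} {a b : Fin n} (h : θ.Hit S a b) :
    s(a, b) ∈ S.sampledEdges θ.seed θ.G θ.F θ.w := by
  obtain ⟨v, ⟨i, k⟩, ⟨h1, rfl, h3⟩, hG, hw⟩ := h
  refine ⟨i, a, k, ?_, ⟨hG, a, mem_phaseComp_self _ _ _ _, b, ?_, rfl⟩, hw⟩
  · rw [componentSketch_eq]
    exact h1
  · rw [Finset.mem_coe, mem_phaseComp_iff_phaseLeader_eq]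
    exact h3

theorem mem_sampledEdges_iff (θ : StepInput n Seed) (e : Sym2 (Fin n)) :
    e ∈ S.sampledEdges θ.seed θ.G θ.F θ.w ↔ ∃ a b, e = s(a, b) ∧ θ.Hit S a b := by
  constructor
  · rintro ⟨i, v, k, hs, ⟨hG, a, ha, b, hb, rfl⟩, hw⟩
    rw [Finset.mem_coe] at ha hb
    have ha' := (mem_phaseComp_iff_phaseLeader_eq _ _ _).1 ha
    rw [mem_phaseComp_iff_phaseLeader_eq] at hb
    refine ⟨a, b, rfl, θ.leader i v, (i, k), ⟨?_, ha', hb⟩, hG, ?_⟩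
    · rw [componentSketch_eq] at hs
      exact hs
    · rw [phaseWeight_eq_of_mem _ _ _ ha]
      exact hw
  · rintro ⟨a, b, rfl, h⟩
    exact Hit.mem_sampledEdges S h

/-- The part of `Hit` that the leader cannot check is visible to the endpoint inside the component.
-/
theorem adj_and_le_iff (θ : StepInput n Seed) (a b : Fin n) (i : Fin (numPhases n)) :
    (θ.G.Adj a b ∧ (θ.w s(a, b) : ℕ∞) ≤ phaseWeight θ.F θ.w i a) ↔
      ∃ y, (θ.view S a).incidentG b = some y ∧ (y : ℕ∞) ≤ (θ.view S a).weight i := by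
  simp only [view, localView]
  by_cases h : θ.G.Adj a b <;> simp [h]

/-- What the nodes are to output. -/
noncomputable def out (θ : StepInput n Seed) (v : Fin n) : StepOutput n β A where
  compSketches i k := θ.leaderSketch S (i, k) v
  notified := {e | ∃ b, e = s(v, b) ∧ (θ.Hit S v b ∨ θ.Hit S b v)}

theorem stepCorrect_out (θ : StepInput n Seed) :
    StepCorrect S θ.seed θ.G θ.F θ.w (θ.out S) := by
  constructor
  · intro i v k
    exact (θ.componentSketch_eq S i k v).symm
  · intro v
    ext e
    simp only [out, Set.mem_ofPred_eq, mem_sampledEdges_iff]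
    constructor
    · rintro ⟨b, rfl, h | h⟩
      · exact ⟨⟨v, b, rfl, h⟩, by simp⟩
      · exact ⟨⟨b, v, Sym2.eq_swap, h⟩, by simp⟩
    · rintro ⟨⟨a, b, rfl, h⟩, hv⟩
      rcases Sym2.mem_iff.1 hv with rfl | rfl
      · exact ⟨b, rfl, Or.inl h⟩
      · exact ⟨a, Sym2.eq_swap, Or.inr h⟩

end StepInput

/-! ### The five communication stages. -/

namespace StepInput

variable {n β T C b : ℕ} {Seed A : Type} [AddCommGroup A] (S : SketchScheme n β Seed A)

theorem leader_eq_of_view_eq {θ θ' : StepInput n Seed} {v : Fin n}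
    (h : θ.view S v = θ'.view S v) (i : Fin (numPhases n)) : θ.leader i v = θ'.leader i v :=
  congrFun (congrArg LocalView.label h) i

theorem sketch_eq_of_view_eq {θ θ' : StepInput n Seed} {v : Fin n}
    (h : θ.view S v = θ'.view S v) (k : Fin (numPhases n) × Fin β) :
    θ.sketch S k v = θ'.sketch S k v :=
  congrFun (congrFun (congrArg LocalView.sketches h) k.1) k.2

variable [NeZero T] [Nonempty Seed] {B Z : Type} [Finite Z]

instance : Nonempty (StepInput n Seed) :=
  ⟨⟨Classical.arbitrary Seed, ⊥, ⊥, fun _ => 0⟩⟩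

/-- What travels in a packet: two node names and a group element. -/
abbrev Payload (n : ℕ) (A : Type) : Type := Fin n × Fin n × A

open Classical in
/-- Every node obtains the partial sums of the sketches over its groups. -/
theorem realizes_groupSketch [AddCommGroup B]
    (hZ : (Nat.card ((Fin n × Fin C) × Z) + 1) ^ (C * C) ≤ n ^ b)
    (relay : B × Fin T ↪ Fin n × Fin C)
    (enc : (Fin n × (Fin (numPhases n) × Fin β)) × Payload n A ↪ (Fin T → Z))
    (slot : Fin n → Fin n × Fin C) (hslot : ∀ u, (slot u).1 = u)
    (helper : (Fin (numPhases n) × Fin β) × Fin T ↪ Fin n × Fin C)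
    (base : Fin (numPhases n) × Fin β ↪ B) (grp : Fin n → Fin T) (off : Fin n → B)
    (hoff : ∀ u u', grp u = grp u' → off u = off u' → u = u') :
    Realizes b 4 (4 * (Fintype.card (Fin n × (Fin (numPhases n) × Fin β)) * T))
      (view S) (fun (θ : StepInput n Seed) v => (θ.view S v, fun k : Fin (numPhases n) × Fin β =>
        (θ.groupRep grp k.1 v, θ.groupSketch S grp k v))) := by
  have hslot' : Function.Injective slot := fun u u' h => by rw [← hslot u, h, hslot]
  -- In a block, packets of one node agree in `k` because `base` is injective. Packets to one helper
  -- agree in `k` and in the group, hence in `off`, which separates the members of a group.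
  have r₁ := realizes_route (n := n) hZ relay enc (x := view S) (fun j => slot j.1)
    (fun j => base j.2 + off j.1)
    (fun (θ : StepInput n Seed) j => some (helper (j.2, grp j.1), (θ.leader j.2.1 j.1, j.1, θ.sketch S j.2 j.1)))
    (by
      rintro ⟨u, k⟩ ⟨u', k'⟩ h h'
      obtain rfl := hslot' h'
      simpa using h)
    (by
      rintro θ ⟨u, k⟩ ⟨u', k'⟩ w d d' h h1 h2
      simp only [Option.some.injEq, Prod.mk.injEq] at h1 h2
      have := helper.injective (h1.1.trans h2.1.symm)
      simp only [Prod.mk.injEq] at this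
      obtain ⟨rfl, hg⟩ := this
      simp only [add_right_inj] at h
      rw [hoff u u' hg h])
    (by
      rintro θ θ' ⟨u, k⟩ h
      simp only [hslot] at h
      simp only [leader_eq_of_view_eq S h, sketch_eq_of_view_eq S h])
  -- The way back uses the same blocks with sources and destinations exchanged.
  have r₂ := realizes_route (n := n) hZ relay enc
    (x := fun (θ : StepInput n Seed) v => (θ.view S v, fun j : Fin n × (Fin (numPhases n) × Fin β) =>
      (some (helper (j.2, grp j.1), ((θ.leader j.2.1 j.1, j.1, θ.sketch S j.2 j.1) :
        Payload n A))).bind fun q => if q.1.1 = v then some q.2 else none))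
    (fun j => helper (j.2, grp j.1)) (fun j => base j.2 + off j.1)
    (fun (θ : StepInput n Seed) j => some (slot j.1, (θ.groupRep grp j.2.1 j.1, j.1, θ.groupSketch S grp j.2 j.1)))
    (by
      rintro ⟨u, k⟩ ⟨u', k'⟩ h h'
      have := helper.injective h'
      simp only [Prod.mk.injEq] at this
      obtain ⟨rfl, hg⟩ := this
      simp only [add_right_inj] at h
      rw [hoff u u' hg h])
    (by
      rintro θ ⟨u, k⟩ ⟨u', k'⟩ w d d' h h1 h2
      simp only [Option.some.injEq, Prod.mk.injEq] at h1 h2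
      obtain rfl := hslot' (h1.1.trans h2.1.symm)
      simpa using h)
    (by
      rintro θ θ' ⟨u, k⟩ h
      simp only [Prod.mk.injEq] at h
      have key : ∀ u', grp u' = grp u → θ.leader k.1 u' = θ'.leader k.1 u' ∧
          θ.sketch S k u' = θ'.sketch S k u' := by
        intro u' hu'
        have := congrFun h.2 (u', k)
        simpa [hu'] using this
      have hc : θ.groupComp grp k.1 u = θ'.groupComp grp k.1 u := by
        ext u'
        simp only [groupComp, Finset.mem_filter, Finset.mem_univ, true_and]
        refine and_congr_right fun hu' => ?_
        rw [(key u' hu').1, (key u rfl).1]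
      have hs : θ.groupSketch S grp k u = θ'.groupSketch S grp k u := by
        unfold groupSketch
        rw [hc]
        refine Finset.sum_congr rfl fun u' hu' => (key u' ?_).2
        simp only [groupComp, Finset.mem_filter] at hu'
        exact hu'.2.1
      simp only [groupRep, hc, hs])
  convert (r₁.trans r₂).determines ?_ using 1
  · ring
  · intro θ θ' v h
    simp only [Prod.mk.injEq] at h ⊢
    refine ⟨h.1.1, funext fun k => ?_⟩
    simpa [hslot] using congrFun h.2 (v, k)

open Classical in
/-- Every leader obtains the sketches of its components. -/
theorem realizes_leaderSketch
    (hZ : (Nat.card ((Fin n × Fin C) × Z) + 1) ^ (C * C) ≤ n ^ b)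
    (relay : B × Fin T ↪ Fin n × Fin C)
    (enc : (Fin n × (Fin (numPhases n) × Fin β)) × Payload n A ↪ (Fin T → Z))
    (slot : Fin n → Fin n × Fin C) (hslot : ∀ u, (slot u).1 = u)
    (base : (Fin (numPhases n) × Fin β) × Fin T ↪ B) (grp : Fin n → Fin T) :
    Realizes b 2 (2 * (Fintype.card (Fin n × (Fin (numPhases n) × Fin β)) * T))
      (fun (θ : StepInput n Seed) v => (θ.view S v, fun k : Fin (numPhases n) × Fin β =>
        (θ.groupRep grp k.1 v, θ.groupSketch S grp k v)))
      (fun (θ : StepInput n Seed) v => (θ.view S v, fun k => θ.leaderSketch S k v)) := by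
  have hslot' : Function.Injective slot := fun u u' h => by rw [← hslot u, h, hslot]
  -- A block fixes `k` and the group, and only the representative sends, so each leader is addressed
  -- at most once per block.
  refine (realizes_route (n := n) hZ relay enc (fun j => slot j.1)
    (fun j => base (j.2, grp j.1))
    (fun (θ : StepInput n Seed) j => if θ.groupRep grp j.2.1 j.1 = j.1 then
      some (slot (θ.leader j.2.1 j.1), (j.1, j.1, θ.groupSketch S grp j.2 j.1)) else none)
    ?_ ?_ ?_).determines ?_
  · rintro ⟨u, k⟩ ⟨u', k'⟩ h h'
    obtain rfl := hslot' h'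
    simpa using h
  · rintro θ ⟨u, k⟩ ⟨u', k'⟩ w d d' h h1 h2
    have := base.injective h
    simp only [Prod.mk.injEq] at this
    obtain ⟨rfl, hg⟩ := this
    simp only [Option.ite_none_right_eq_some, Option.some.injEq, Prod.mk.injEq] at h1 h2
    obtain ⟨h3, h4, -⟩ := h1
    obtain ⟨h3', h4', -⟩ := h2
    have := groupRep_congr hg (hslot' (h4.trans h4'.symm))
    rw [h3, h3'] at this
    rw [this]
  · rintro θ θ' ⟨u, k⟩ h
    simp only [hslot, Prod.mk.injEq] at h
    have h2 := congrFun h.2 k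
    simp only [Prod.mk.injEq] at h2
    simp only [leader_eq_of_view_eq S h.1, h2.1, h2.2]
  · intro θ θ' v h
    simp only [Prod.mk.injEq] at h ⊢
    refine ⟨h.1.1, funext fun k => ?_⟩
    rw [← sum_groupSketch S grp θ, ← sum_groupSketch S grp θ']
    refine Finset.sum_congr rfl fun u _ => ?_
    -- A missing packet counts as `0` in the sum over all nodes.
    have := congrArg (fun o => Option.elim o 0 fun d => d.2.2) (congrFun h.2 (u, k))
    have aux : ∀ θ : StepInput n Seed, (Option.elim ((if θ.groupRep grp k.1 u = u then
        some (slot (θ.leader k.1 u), ((u, u, θ.groupSketch S grp k u) : Payload n A))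
          else none).bind fun q => if q.1.1 = v then some q.2 else none) 0 fun d => d.2.2) =
        if θ.groupRep grp k.1 u = u ∧ θ.leader k.1 u = v then θ.groupSketch S grp k u else 0 := by
      intro θ
      by_cases h1 : θ.groupRep grp k.1 u = u <;> by_cases h2 : θ.leader k.1 u = v <;>
        simp [h1, h2, hslot]
    rw [← aux θ, ← aux θ']
    exact this

open Classical in
/-- Every leader learns the members of its components. -/
theorem realizes_members (hb : 2 ^ numPhases n ≤ n ^ b) :
    Realizes b 1 (n * numPhases n)
      (fun (θ : StepInput n Seed) v => (θ.view S v, fun k => θ.leaderSketch S k v))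
      (fun (θ : StepInput n Seed) v => ((θ.view S v, fun k => θ.leaderSketch S k v),
        fun (u : Fin n) (i : Fin (numPhases n)) => θ.leader i u = v)) := by
  refine (realizes_oneRound (X := Finset (Fin (numPhases n))) (by simpa using hb)
    (fun (θ : StepInput n Seed) u v => if ∃ i : Fin (numPhases n), θ.leader i u = v then
      some (Finset.univ.filter fun i : Fin (numPhases n) => θ.leader i u = v) else none)
    ?_ ?_).determines ?_
  · intro θ θ' u h
    simp only [Prod.mk.injEq] at h
    simp only [leader_eq_of_view_eq S h.1]
  · intro θ
    refine (sum_isSome_le_card (ι := Fin n × Fin (numPhases n)) _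
      (fun j => (j.1, θ.leader j.2 j.1)) ?_).trans (by simp)
    intro u v h
    by_cases hi : ∃ i : Fin (numPhases n), θ.leader i u = v
    · obtain ⟨i, hi⟩ := hi
      exact ⟨(u, i), by simp [hi]⟩
    · simp [hi] at h
  · intro θ θ' v h
    rw [Prod.mk.injEq] at h ⊢
    refine ⟨h.1, ?_⟩
    funext u i
    have aux : ∀ θ : StepInput n Seed, (θ.leader i u = v) ↔ ∃ s, (if ∃ i : Fin (numPhases n),
        θ.leader i u = v then some (Finset.univ.filter fun i : Fin (numPhases n) =>
          θ.leader i u = v) else none) = some s ∧ i ∈ s := by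
      intro θ
      constructor
      · intro h
        have : ∃ i : Fin (numPhases n), θ.leader i u = v := ⟨i, h⟩
        exact ⟨_, if_pos this, by simpa using h⟩
      · rintro ⟨s, hs, hi⟩
        simp only [Option.ite_none_right_eq_some, Option.some.injEq] at hs
        rw [← hs.2] at hi
        simpa using hi
    rw [aux θ, aux θ']
    have := congrFun h.2 u
    rw [this]

open Classical in
/-- Every sampled edge becomes known to its endpoint inside the sampling component. -/
theorem realizes_hit
    (hZ : (Nat.card ((Fin n × Fin C) × Z) + 1) ^ (C * C) ≤ n ^ b)
    (relay : B × Fin T ↪ Fin n × Fin C)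
    (enc : (Fin n × (Fin (numPhases n) × Fin β)) × Payload n A ↪ (Fin T → Z))
    (slot : Fin n → Fin n × Fin C) (hslot : ∀ u, (slot u).1 = u)
    (base : Fin (numPhases n) × Fin β ↪ B) :
    Realizes b 2 (2 * (Fintype.card (Fin n × (Fin (numPhases n) × Fin β)) * T))
      (fun (θ : StepInput n Seed) v => ((θ.view S v, fun k => θ.leaderSketch S k v),
        fun (u : Fin n) (i : Fin (numPhases n)) => θ.leader i u = v))
      (fun (θ : StepInput n Seed) v => ((fun k => θ.leaderSketch S k v), θ.Hit S v)) := by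
  have hslot' : Function.Injective slot := fun u u' h => by rw [← hslot u, h, hslot]
  -- For a fixed `k` a node lies in one component only, so it is addressed by one leader and the
  -- block may depend on `k` alone. The group element in the payload is a dummy.
  refine (realizes_route (n := n) hZ relay enc (fun j => slot j.1) (fun j => base j.2)
    (fun (θ : StepInput n Seed) j => (pick (θ.Candidate S j.2 j.1)).map fun q => (slot q.1, (q.1, q.2, 0)))
    ?_ ?_ ?_).determines ?_
  · rintro ⟨u, k⟩ ⟨u', k'⟩ h h'
    exact Prod.ext (hslot' h') (base.injective h)
  · rintro θ ⟨u, k⟩ ⟨u', k'⟩ w d d' h h1 h2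
    obtain rfl := base.injective h
    simp only [Option.map_eq_some_iff, pick_candidate_eq_some] at h1 h2
    obtain ⟨q, hq, hq'⟩ := h1
    obtain ⟨q', hp, hp'⟩ := h2
    have := hslot' ((congrArg Prod.fst hq').trans (congrArg Prod.fst hp').symm)
    rw [← hq.2.1, ← hp.2.1, this]
  · rintro θ θ' ⟨u, k⟩ h
    simp only [hslot, Prod.mk.injEq] at h
    have : θ.Candidate S k u = θ'.Candidate S k u := by
      funext q
      have h1 := congrArg LocalView.seed h.1.1
      have h2 := congrFun h.1.2 k
      have h3 := fun v => congrFun (congrFun h.2 v) k.1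
      simp only [view, localView] at h1
      simp only [Candidate, h1, h2, ne_eq]
      rw [h3, h3]
    simp only [this]
  · intro θ θ' v h
    simp only [Prod.mk.injEq] at h ⊢
    refine ⟨h.1.1.2, ?_⟩
    funext c
    have aux : ∀ θ : StepInput n Seed, ∀ u k, θ.Candidate S k u (v, c) ↔
        ((pick (θ.Candidate S k u)).map fun q =>
          (slot q.1, ((q.1, q.2, 0) : Payload n A))).bind
          (fun q => if q.1.1 = v then some q.2 else none) = some (v, c, 0) := by
      intro θ u k
      simp only [Option.bind_eq_some_iff, Option.map_eq_some_iff, pick_candidate_eq_some]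
      constructor
      · intro h
        exact ⟨_, ⟨_, h, rfl⟩, by simp [hslot]⟩
      · rintro ⟨_, ⟨⟨q, q'⟩, hc, rfl⟩, h'⟩
        simp only [hslot, Option.ite_none_right_eq_some, Option.some.injEq, Prod.mk.injEq] at h'
        obtain ⟨rfl, -, rfl, -⟩ := h'
        exact hc
    unfold Hit
    simp only [adj_and_le_iff S]
    refine propext (exists_congr fun u => exists_congr fun k => and_congr ?_ ?_)
    · rw [aux θ, aux θ', ← congrFun h.2 (u, k)]
    · rw [h.1.1.1]

open Classical in
/-- The endpoints of the sampled edges notify each other. -/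
theorem realizes_out (hb : 1 ≤ n ^ b) :
    Realizes b 1 (Fintype.card (Fin n × (Fin (numPhases n) × Fin β)))
      (fun (θ : StepInput n Seed) v => ((fun k => θ.leaderSketch S k v), θ.Hit S v)) (fun (θ : StepInput n Seed) => θ.out S) := by
  refine (realizes_oneRound (X := Unit) (by simpa using hb)
    (fun (θ : StepInput n Seed) u v => if θ.Hit S u v then some () else none) ?_ ?_).determines ?_
  · intro θ θ' u h
    simp only [Prod.mk.injEq] at h
    simp only [h.2]
  · intro θ
    -- The sender and `k` fix the leader and hence the edge, so there is at most one message per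
    -- pair; the default value is irrelevant.
    refine sum_isSome_le_card _ (fun j => (pick (θ.Candidate S j.2 (θ.leader j.2.1 j.1))).getD
      (j.1, j.1)) ?_
    intro u v h
    have hh : θ.Hit S u v := by
      by_contra hh
      simp [hh] at h
    obtain ⟨l, k, hc, -⟩ := hh
    obtain rfl := hc.2.1
    refine ⟨(u, k), ?_⟩
    rw [(pick_candidate_eq_some S _).2 hc, Option.getD_some]
  · intro θ θ' v h
    simp only [Prod.mk.injEq] at h
    have h1 : ∀ c, θ.Hit S c v ↔ θ'.Hit S c v := by
      intro c
      have := congrFun h.2 c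
      by_cases h1 : θ.Hit S c v <;> by_cases h2 : θ'.Hit S c v <;> simp_all
    have h2 : ∀ k, θ.leaderSketch S k v = θ'.leaderSketch S k v := congrFun h.1.1
    simp only [out, h.1.2, h1, h2]

/-- The whole step, given embeddings that assign helpers, relays and blocks. -/
theorem realizes_step [AddCommGroup B]
    (hZ : (Nat.card ((Fin n × Fin C) × Z) + 1) ^ (C * C) ≤ n ^ b)
    (hb : 2 ^ numPhases n ≤ n ^ b)
    (relay : B × Fin T ↪ Fin n × Fin C)
    (enc : (Fin n × (Fin (numPhases n) × Fin β)) × Payload n A ↪ (Fin T → Z))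
    (slot : Fin n → Fin n × Fin C) (hslot : ∀ u, (slot u).1 = u)
    (helper : (Fin (numPhases n) × Fin β) × Fin T ↪ Fin n × Fin C)
    (base : (Fin (numPhases n) × Fin β) × Fin T ↪ B) (place : Fin n ↪ Fin T × B) :
    Realizes b 10 (9 * (n * (numPhases n * β) * T) + n * numPhases n)
      (view S) (fun (θ : StepInput n Seed) => θ.out S) := by
  have hT : 1 ≤ T := NeZero.one_le
  let base' : Fin (numPhases n) × Fin β ↪ B :=
    ⟨fun k => base (k, 0), fun k k' h => (Prod.mk.inj (base.injective h)).1⟩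
  obtain ⟨P, hP⟩ := ((((realizes_groupSketch S hZ relay enc slot hslot helper base'
    (fun u => (place u).1) (fun u => (place u).2)
    (fun u u' h h' => place.injective (Prod.ext h h'))).trans
    (realizes_leaderSketch S hZ relay enc slot hslot base (fun u => (place u).1))).trans
    (realizes_members S hb)).trans (realizes_hit S hZ relay enc slot hslot base')).trans
    (realizes_out S (Nat.one_le_two_pow.trans hb))
  refine ⟨P, fun θ => ⟨(hP θ).1, (hP θ).2.trans ?_⟩⟩
  simp only [Fintype.card_prod, Fintype.card_fin]
  -- The routings cost 4 + 2 + 2 = 8 times nQT; the final notifications, at most nQ, account for the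
  -- ninth.
  have : n * (numPhases n * β) * 1 ≤ n * (numPhases n * β) * T := Nat.mul_le_mul_left _ hT
  linarith

end StepInput

/-! ### Choice of parameters and numerical estimates. -/

theorem two_pow_numPhases_le {n : ℕ} (hn : 2 ≤ n) : 2 ^ numPhases n ≤ n ^ 3 := by
  have h1 : 2 ^ (Nat.clog 2 n).pred < n := Nat.pow_pred_clog_lt_self one_lt_two (by omega)
  have h2 : 0 < Nat.clog 2 n := Nat.clog_pos one_lt_two hn
  have h3 : numPhases n = (Nat.clog 2 n).pred + 2 := by
    unfold numPhases
    rw [Nat.pred_eq_sub_one]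
    omega
  rw [h3, pow_add]
  have h4 : 2 ^ 2 ≤ n ^ 2 := Nat.pow_le_pow_left hn 2
  calc _ ≤ n * n ^ 2 := Nat.mul_le_mul h1.le h4
    _ = n ^ 3 := by ring

/-- The step can be realized if the number `numPhases n * β` of sketches of a node and the number
`T` of messages that fit a group element are small enough. -/
theorem StepInput.realizes_step_of_le {n β T E κ : ℕ} {Seed A : Type} [AddCommGroup A] [Finite A]
    [Nonempty Seed] (S : SketchScheme n β Seed A) (hn : 2 ≤ n) (hT : 1 ≤ T)
    (hA : Nat.card A ≤ n ^ T) (hE : numPhases n * β * T * T ≤ E * n) (hTE : T ≤ E * n)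
    (hκ : 2 * E + 1 ≤ 2 ^ κ) :
    Realizes ((2 * κ + 7) * (2 ^ κ * 2 ^ κ)) 10
      (9 * (n * (numPhases n * β) * T) + n * numPhases n) (view S)
      (fun (θ : StepInput n Seed) => θ.out S) := by
  have := Fintype.ofFinite A
  have : NeZero T := ⟨by omega⟩
  have hnpos : 0 < n := by omega
  set Q := numPhases n * β with hQ
  have hCn : 2 ^ κ ≤ n ^ κ := Nat.pow_le_pow_left hn κ
  have hQT : Q * T ≤ Q * T * T := Nat.le_mul_of_pos_right _ hT
  have hQQ : Q ≤ Q * T := Nat.le_mul_of_pos_right _ hT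
  have hEn : 2 * (E * n) + n ≤ n * 2 ^ κ := by nlinarith
  have hQn : Q ≤ n ^ (κ + 1) := by
    rw [pow_succ]
    nlinarith
  -- `Q * T` blocks separate all pairs of a sketch and a group; `n / T + 1` more let T groups of at
  -- most `B` nodes hold all nodes.
  let B := Q * T + n / T + 1
  have hB : B * T ≤ n * 2 ^ κ := by
    have : n / T * T ≤ n := Nat.div_mul_le_self n T
    calc B * T = Q * T * T + n / T * T + T := by simp only [B]; ring
      _ ≤ _ := by linarith
  have : NeZero B := ⟨by simp [B]⟩
  obtain ⟨relay⟩ : Nonempty (ZMod B × Fin T ↪ Fin n × Fin (2 ^ κ)) := by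
    apply Function.Embedding.nonempty_of_card_le
    simpa [ZMod.card] using hB
  obtain ⟨helper⟩ : Nonempty ((Fin (numPhases n) × Fin β) × Fin T ↪ Fin n × Fin (2 ^ κ)) := by
    apply Function.Embedding.nonempty_of_card_le
    simp only [Fintype.card_prod, Fintype.card_fin, ← hQ]
    linarith
  obtain ⟨base⟩ : Nonempty ((Fin (numPhases n) × Fin β) × Fin T ↪ ZMod B) := by
    apply Function.Embedding.nonempty_of_card_le
    simp only [Fintype.card_prod, Fintype.card_fin, ← hQ, ZMod.card, B]
    exact Nat.le_add_right_of_le (Nat.le_add_right _ _)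
  obtain ⟨place⟩ : Nonempty (Fin n ↪ Fin T × ZMod B) := by
    apply Function.Embedding.nonempty_of_card_le
    simp only [Fintype.card_prod, Fintype.card_fin, ZMod.card, B]
    have := Nat.lt_mul_div_succ n (show 0 < T by omega)
    nlinarith
  -- Index and payload take at most n^(κ + 4 + T) values, and κ + 4 + T ≤ (κ + 5)T because T ≥ 1.
  obtain ⟨enc⟩ : Nonempty ((Fin n × (Fin (numPhases n) × Fin β)) × Payload n A ↪
      (Fin T → Fin (n ^ (κ + 5)))) := by
    apply Function.Embedding.nonempty_of_card_le
    simp only [Fintype.card_prod, Fintype.card_fin, ← hQ, Fintype.card_fun, Payload]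
    rw [Nat.card_eq_fintype_card] at hA
    calc n * Q * (n * (n * Fintype.card A))
        ≤ n * n ^ (κ + 1) * (n * (n * n ^ T)) := by gcongr
      _ = n ^ (κ + 4 + T) := by ring
      _ ≤ n ^ ((κ + 5) * T) := Nat.pow_le_pow_right hnpos (by nlinarith)
      _ = _ := by rw [pow_mul]
  refine StepInput.realizes_step S (C := 2 ^ κ) (Z := Fin (n ^ (κ + 5))) ?_ ?_ relay enc
    (fun u => (u, ⟨0, by positivity⟩)) (fun _ => rfl) helper base place
  · rw [pow_mul n]
    refine Nat.pow_le_pow_left ?_ _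
    simp only [Nat.card_eq_fintype_card, Fintype.card_prod, Fintype.card_fin]
    calc n * 2 ^ κ * n ^ (κ + 5) + 1 ≤ n * n ^ κ * n ^ (κ + 5) + 1 := by gcongr
      _ = n ^ (2 * κ + 6) + 1 := by ring
      _ ≤ n ^ (2 * κ + 6) * n := by
        have : 1 ≤ n ^ (2 * κ + 6) := Nat.one_le_pow _ _ hnpos
        nlinarith
      _ = n ^ (2 * κ + 7) := by ring
  · refine (two_pow_numPhases_le hn).trans (Nat.pow_le_pow_right hnpos ?_)
    have : 1 ≤ 2 ^ κ * 2 ^ κ := Nat.one_le_iff_ne_zero.2 (by positivity)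
    nlinarith

theorem one_le_two_mul_log {n : ℕ} (hn : 2 ≤ n) : 1 ≤ 2 * Real.log n := by
  have h : Real.log 2 ≤ Real.log n := Real.log_le_log (by norm_num) (by exact_mod_cast hn)
  linarith [Real.log_two_gt_d9]

theorem numPhases_le_log {n : ℕ} (hn : 2 ≤ n) : (numPhases n : ℝ) ≤ 3 * (2 * Real.log n) := by
  have h1 := one_le_two_mul_log hn
  have h2 : (Nat.clog 2 n : ℝ) < Real.logb 2 n + 1 := by
    have := Real.natCeil_logb_natCast 2 n
    rw [← this]
    exact Nat.ceil_lt_add_one (Real.logb_nonneg (by norm_num) (by exact_mod_cast (by omega)))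
  have h3 : Real.logb 2 n ≤ 2 * Real.log n := by
    rw [Real.logb, div_le_iff₀ (Real.log_pos one_lt_two)]
    nlinarith [Real.log_two_gt_d9]
  unfold numPhases
  push_cast
  linarith

/-- Here γ < 1 leaves room: the 12th power of log n is O(n^(1 - γ)). The exponent 12 is that of QT²,
namely 6 + 2 · 3. -/
theorem log_pow_div_le {γ p : ℝ} (hγ : γ < 1) {n : ℕ} (hn : 2 ≤ n) (hp : (n : ℝ) ^ (-γ) ≤ p) :
    (2 * Real.log n) ^ 12 / p ≤ (2 / ((1 - γ) / 12)) ^ 12 * n := by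
  have hn0 : (0 : ℝ) < n := by exact_mod_cast (by omega)
  have hε : 0 < (1 - γ) / 12 := by linarith
  have hp0 : 0 < p := lt_of_lt_of_le (Real.rpow_pos_of_pos hn0 _) hp
  have hx := one_le_two_mul_log hn
  have h1 : Real.log n ≤ (n : ℝ) ^ ((1 - γ) / 12) / ((1 - γ) / 12) :=
    Real.log_le_rpow_div hn0.le hε
  have h2 : (2 * Real.log n) ^ 12 ≤
      (2 / ((1 - γ) / 12)) ^ 12 * (n : ℝ) ^ (1 - γ) := by
    calc (2 * Real.log n) ^ 12
        ≤ (2 * ((n : ℝ) ^ ((1 - γ) / 12) / ((1 - γ) / 12))) ^ 12 := by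
          refine pow_le_pow_left₀ (by linarith) (by linarith) _
      _ = (2 / ((1 - γ) / 12)) ^ 12 * ((n : ℝ) ^ ((1 - γ) / 12)) ^ 12 := by
          rw [← mul_pow]
          congr 1
          ring
      _ = _ := by
          rw [← Real.rpow_mul_natCast hn0.le]
          congr 2
          push_cast
          ring
  rw [div_le_iff₀ hp0]
  calc _ ≤ (2 / ((1 - γ) / 12)) ^ 12 * (n : ℝ) ^ (1 - γ) := h2
    _ = (2 / ((1 - γ) / 12)) ^ 12 * n * (n : ℝ) ^ (-γ) := by
      rw [sub_eq_add_neg, Real.rpow_add hn0, Real.rpow_one]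
      ring
    _ ≤ _ := by gcongr

/-- A group element of `L * log n ^ 4` bits fits into `T` messages of `log n` bits. -/
theorem card_le_pow_of_logb_le {n N T : ℕ} {L : ℝ} (hn : 2 ≤ n) (hN : 0 < N) (hL : 0 ≤ L)
    (h : Real.logb 2 N ≤ L * Real.log n ^ 4) (hT : L * Real.log n ^ 3 ≤ T) : N ≤ n ^ T := by
  have hlog : 0 ≤ Real.log n := by linarith [one_le_two_mul_log hn]
  have h1 : Real.log N ≤ L * Real.log n ^ 4 := by
    rw [Real.logb, div_le_iff₀ (Real.log_pos one_lt_two)] at h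
    refine h.trans ?_
    have : 0 ≤ L * Real.log n ^ 4 := by positivity
    nlinarith [Real.log_two_lt_d9]
  have h2 : Real.log N ≤ Real.log ((n : ℝ) ^ T) := by
    rw [Real.log_pow]
    calc _ ≤ L * Real.log n ^ 3 * Real.log n := by linarith
      _ ≤ _ := by gcongr
  have h3 := (Real.log_le_log_iff (by exact_mod_cast hN)
    (pow_pos (by exact_mod_cast (by omega)) T)).1 h2
  exact_mod_cast h3

theorem mainTheorem9 (γ K L : ℝ) (hγ : γ < 1) (c : ℕ) :
    ∃ (b R d : ℕ) (M : ℝ),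
      ∀ (n : ℕ) (p : ℝ), 2 ≤ n → (n : ℝ) ^ (-γ) ≤ p → p ≤ 1 →
      ∀ β : ℕ, (β : ℝ) ≤ K * (Real.log n ^ 5 / p) →
      ∀ (Seed A : Type) [AddCommGroup A] [Finite A],
        Real.logb 2 (Nat.card A) ≤ L * Real.log n ^ 4 →
      ∀ S : SketchScheme n β Seed A,
      ∃ P : CliqueProtocol n b (LocalView n β Seed A) (StepOutput n β A),
      ∀ (r : Seed) (G F : SimpleGraph (Fin n)) (w : Sym2 (Fin n) → ℕ),
        F ≤ G → F.IsAcyclic → Set.InjOn w G.edgeSet → (∀ e ∈ G.edgeSet, w e < n ^ c) →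
          StepCorrect S r G F w (P.result (localView S r G F w) R) ∧
          (P.messageCount (localView S r G F w) R : ℝ) ≤ M * (n / p) * Real.log n ^ d := by
  set K' := max K 0
  set L' := max L 0
  have hK' : 0 ≤ K' := le_max_right _ _
  have hL' : 0 ≤ L' := le_max_right _ _
  set H := (2 / ((1 - γ) / 12)) ^ 12
  have hH : 0 ≤ H := Even.pow_nonneg (by decide) _
  set E := ⌈(3 * K' * (L' + 2) ^ 2 + (L' + 2)) * H⌉₊ with hE
  obtain ⟨κ, hκ⟩ : ∃ κ, 2 * E + 1 ≤ 2 ^ κ := ⟨_, Nat.lt_two_pow_self.le⟩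
  -- The exponent 9 = 6 + 3 comes from QT, and 512 = 2^9 from working with 2 log n.
  refine ⟨(2 * κ + 7) * (2 ^ κ * 2 ^ κ), 10, 9, 512 * (27 * K' * (L' + 2) + 3), ?_⟩
  intro n p hn hp hp1 β hβ Seed A _ _ hA S
  rcases isEmpty_or_nonempty Seed with hS | hS
  -- Without seeds there is nothing to satisfy, and any protocol will do.
  · exact ⟨⟨Unit, fun _ _ => (), fun _ _ _ _ => none, fun _ _ _ _ => (),
      fun _ _ => ⟨fun _ _ => 0, ∅⟩⟩, fun r => hS.elim r⟩
  have hn0 : (0 : ℝ) < n := by exact_mod_cast (by omega)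
  have hp0 : 0 < p := lt_of_lt_of_le (Real.rpow_pos_of_pos hn0 _) hp
  have hx := one_le_two_mul_log hn
  have hH' := log_pow_div_le hγ hn hp
  have hph := numPhases_le_log hn
  -- The factor 2 makes x ≥ 1 already for n = 2, so powers of x increase with the exponent.
  set x := 2 * Real.log n with hxdef
  have hlog : Real.log n = x / 2 := by rw [hxdef]; ring
  have hx0 : 0 ≤ x := by linarith
  set T := ⌈L' * Real.log n ^ 3⌉₊ + 1 with hTdef
  have hT : (T : ℝ) ≤ (L' + 2) * x ^ 3 := by
    have h1 : (⌈L' * Real.log n ^ 3⌉₊ : ℝ) < L' * Real.log n ^ 3 + 1 :=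
      Nat.ceil_lt_add_one (by rw [hlog]; positivity)
    have h2 : L' * Real.log n ^ 3 ≤ L' * x ^ 3 := by
      rw [hlog]
      gcongr
      linarith
    have h3 : 1 ≤ x ^ 3 := one_le_pow₀ hx
    rw [hTdef]
    push_cast
    linarith
  have hβ' : (β : ℝ) ≤ K' * (x ^ 5 / p) := by
    refine hβ.trans ?_
    rw [hlog]
    gcongr
    · exact le_max_left _ _
    · linarith
  have hQ : ((numPhases n * β : ℕ) : ℝ) ≤ 3 * K' * (x ^ 6 / p) := by
    push_cast
    calc (numPhases n : ℝ) * β ≤ 3 * x * (K' * (x ^ 5 / p)) := by gcongr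
      _ = _ := by ring
  have hQT : ((numPhases n * β * T : ℕ) : ℝ) ≤ 3 * K' * (L' + 2) * (x ^ 9 / p) := by
    rw [Nat.cast_mul]
    calc _ ≤ 3 * K' * (x ^ 6 / p) * ((L' + 2) * x ^ 3) := by gcongr
      _ = _ := by ring
  have hx12 : x ^ 3 ≤ x ^ 12 / p := by
    rw [le_div_iff₀ hp0]
    calc x ^ 3 * p ≤ x ^ 3 * 1 := by gcongr
      _ ≤ x ^ 12 := by
        rw [mul_one]
        exact pow_le_pow_right₀ hx (by norm_num)
  have hEle : (3 * K' * (L' + 2) ^ 2 + (L' + 2)) * H ≤ E := Nat.le_ceil _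
  have hEn : 3 * K' * (L' + 2) ^ 2 * (x ^ 12 / p) + (L' + 2) * (x ^ 12 / p) ≤ E * n := by
    calc _ = (3 * K' * (L' + 2) ^ 2 + (L' + 2)) * (x ^ 12 / p) := by ring
      _ ≤ (3 * K' * (L' + 2) ^ 2 + (L' + 2)) * (H * n) := by gcongr
      _ = (3 * K' * (L' + 2) ^ 2 + (L' + 2)) * H * n := by ring
      _ ≤ _ := by gcongr
  have hpos1 : 0 ≤ 3 * K' * (L' + 2) ^ 2 * (x ^ 12 / p) := by positivity
  have hpos2 : 0 ≤ (L' + 2) * (x ^ 12 / p) := by positivity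
  have hTE : T ≤ E * n := by
    have : (T : ℝ) ≤ E * n :=
      calc _ ≤ (L' + 2) * x ^ 3 := hT
        _ ≤ (L' + 2) * (x ^ 12 / p) := by gcongr
        _ ≤ _ := by linarith
    exact_mod_cast this
  have hQTT : numPhases n * β * T * T ≤ E * n := by
    have : ((numPhases n * β * T * T : ℕ) : ℝ) ≤ E * n := by
      rw [Nat.cast_mul]
      calc _ ≤ 3 * K' * (L' + 2) * (x ^ 9 / p) * ((L' + 2) * x ^ 3) := by gcongr
        _ = 3 * K' * (L' + 2) ^ 2 * (x ^ 12 / p) := by ring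
        _ ≤ _ := by linarith
    exact_mod_cast this
  have hcard : Nat.card A ≤ n ^ T := by
    refine card_le_pow_of_logb_le hn Nat.card_pos hL' (hA.trans ?_) ?_
    · gcongr
      exact le_max_left _ _
    · rw [hTdef]
      push_cast
      linarith [Nat.le_ceil (L' * Real.log n ^ 3)]
  obtain ⟨P, hP⟩ := StepInput.realizes_step_of_le S hn (by omega) hcard hQTT hTE hκ
  refine ⟨P, fun r G F w _ _ _ _ => ?_⟩
  obtain ⟨h1, h2⟩ := hP ⟨r, G, F, w⟩
  constructor
  · have : P.result (localView S r G F w) 10 = StepInput.out S ⟨r, G, F, w⟩ := funext h1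
    rw [this]
    exact StepInput.stepCorrect_out S ⟨r, G, F, w⟩
  · have hle : (P.messageCount (localView S r G F w) 10 : ℝ) ≤
        ((9 * (n * (numPhases n * β) * T) + n * numPhases n : ℕ) : ℝ) := by
      exact_mod_cast h2
    refine hle.trans ?_
    have hx9 : x ≤ x ^ 9 / p := by
      rw [le_div_iff₀ hp0]
      calc x * p ≤ x * 1 := by gcongr
        _ ≤ x ^ 9 := by
          rw [mul_one]
          exact le_self_pow₀ hx (by norm_num)
    calc ((9 * (n * (numPhases n * β) * T) + n * numPhases n : ℕ) : ℝ)
        = n * (9 * ((numPhases n * β * T : ℕ) : ℝ) + numPhases n) := by push_cast; ring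
      _ ≤ n * (9 * (3 * K' * (L' + 2) * (x ^ 9 / p)) + 3 * (x ^ 9 / p)) := by
        gcongr
        exact hph.trans (by gcongr)
      _ = _ := by rw [hlog]; ring
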